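/- Let $F$ be a free pro-$2$ group of arbitrary (possibly infinite) rank, that is, a pro-$2$ group with a basis converging to $1$. Let $a,b,c\in F$ satisfy $a^2b^2c^2=1$. Then the closed subgroup $H=\overline{\langle a,b,c\rangle}$ of $F$ generated by $a,b,c$ is abelian; moreover $H$ is procyclic, i.e. $H=\overline{\langle g\rangle}$ for some $g\in F$. Here a subset $B$ of a pro-$2$ group $F$ is a basis converging to $1$ if every neighbourhood of $1$ contains all but finitely many elements of $B$, $B$ generates $F$ topologically, and every map $\varphi\colon B\to P$ to a pro-$2$ group $P$ such that every neighbourhood of $1$ in $P$ contains $\varphi(x)$ for all but finitely many $x\in B$ extends uniquely to a continuous homomorphism $F\to P$. -/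

import Mathlib

open Filter Topology

universe u

/-- `G` is a pro-`p` group: a profinite (compact, Hausdorff, totally disconnected) topological
group all of whose quotients by open normal subgroups (which are finite) are `p`-groups. -/
structure IsProP (p : ℕ) (G : Type u) [Group G] [TopologicalSpace G] [IsTopologicalGroup G] :
    Prop where
  compactSpace : CompactSpace G
  t2Space : T2Space G
  totallyDisconnectedSpace : TotallyDisconnectedSpace G
  isPGroup_quotient : ∀ U : OpenNormalSubgroup G, IsPGroup p (G ⧸ U.toSubgroup)

/-- A family of elements of a topological group converges to `1` if every neighbourhood of `1`
contains all but finitely many of its members. -/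
def ConvergesToOne {X G : Type u} [Group G] [TopologicalSpace G] (φ : X → G) : Prop :=
  Tendsto φ cofinite (𝓝 1)

/-- The closed subgroup of a topological group generated by a subset. -/
def closedSubgroupGenerated {G : Type u} [Group G] [TopologicalSpace G] [IsTopologicalGroup G]
    (S : Set G) : Subgroup G :=
  (Subgroup.closure S).topologicalClosure

/-- `B` is a basis (converging to `1`) of the pro-`p` group `F`: it converges to `1`, it
generates `F` topologically, and every map from `B` to a pro-`p` group that converges to `1`
extends uniquely to a continuous homomorphism on `F`. -/
structure IsProPBasis (p : ℕ) (F : Type u) [Group F] [TopologicalSpace F] [IsTopologicalGroup F]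
    (B : Set F) : Prop where
  convergesToOne : ConvergesToOne (fun b : B => (b : F))
  generates : closedSubgroupGenerated B = ⊤
  existsUnique_extension : ∀ (P : Type u) [Group P] [TopologicalSpace P] [IsTopologicalGroup P],
    IsProP p P → ∀ φ : B → P, ConvergesToOne φ →
      ∃! f : F →* P, Continuous f ∧ ∀ b : B, f b = φ b

/-- `F` is a free pro-`p` group, of arbitrary rank: a pro-`p` group with a basis converging
to `1`. -/
def IsFreeProP (p : ℕ) (F : Type u) [Group F] [TopologicalSpace F] [IsTopologicalGroup F] :
    Prop :=
  IsProP p F ∧ ∃ B : Set F, IsProPBasis p F B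

/-- A subgroup of a topological group is procyclic (in the sense of profinite groups) if it is
the closed subgroup generated by a single element. -/
def IsProcyclicSubgroup {G : Type u} [Group G] [TopologicalSpace G] [IsTopologicalGroup G]
    (H : Subgroup G) : Prop :=
  ∃ g : G, H = closedSubgroupGenerated {g}

/-! Let `S` be the image of ⟨a, b, c⟩ in a finite quotient of `F`. By
`IsFreeProP.exists_lift_comap`, the preimage of `S` inherits projectivity from `F`. Lifting a
character v : `S` → ℤ/2 to ℤ/4 gives 2(a + b + c) = 0 there, so v(a) + v(b) + v(c) = 0. If neither a
nor b generates `S`, there are nonzero characters v, w with v(a) = 0 and w(b) = 0; then (v, w) is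
nontrivial on each of a, b, c. Lifted to the quaternion group of order 8, all three squares become
-1, with product -1 ≠ 1. So a or b generates every finite image, and compactness selects one of them
for all. -/

/-- A finite discrete `p`-group is pro-`p`. -/
theorem isProP_of_finite {p : ℕ} {G : Type u} [Group G] [TopologicalSpace G]
    [IsTopologicalGroup G] [DiscreteTopology G] [Finite G] (hG : IsPGroup p G) : IsProP p G where
  compactSpace := inferInstance
  t2Space := inferInstance
  totallyDisconnectedSpace := inferInstance
  isPGroup_quotient U := hG.to_quotient U.toSubgroup

/-- Free pro-`p` groups are projective with respect to surjections of finite `p`-groups. -/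
theorem IsFreeProP.exists_lift {p : ℕ} {F : Type u} [Group F] [TopologicalSpace F]
    [IsTopologicalGroup F] (hF : IsFreeProP p F) {A B : Type u} [Group A] [Group B] [Finite A]
    [Finite B] (hA : IsPGroup p A) (hB : IsPGroup p B) (π : A →* B) (hπ : Function.Surjective π)
    (f : F →* B) (hf : IsOpen (f.ker : Set F)) : ∃ f' : F →* A, π.comp f' = f := by
  obtain ⟨-, S, hS⟩ := hF
  let : TopologicalSpace A := ⊥
  let : TopologicalSpace B := ⊥
  have : DiscreteTopology A := ⟨rfl⟩
  have : DiscreteTopology B := ⟨rfl⟩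
  have hfc : Continuous f := by
    refine continuous_of_continuousAt_one f ?_
    rw [ContinuousAt, map_one, nhds_discrete B, tendsto_pure]
    exact hf.mem_nhds (one_mem f.ker)
  classical
  -- The section must send 1 to 1, so that lifting the basis preserves convergence to 1.
  let σ : B → A := fun b => if b = 1 then 1 else Function.surjInv hπ b
  have hσ (b : B) : π (σ b) = b := by
    by_cases hb : b = 1
    · simp [σ, hb]
    · simp [σ, hb, Function.surjInv_eq hπ]
  have hev : ∀ᶠ s : S in cofinite, f s = 1 :=
    hS.convergesToOne.eventually (hf.mem_nhds (one_mem f.ker))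
  have hconvA : ConvergesToOne (fun s : S => σ (f s)) := by
    rw [ConvergesToOne, nhds_discrete, tendsto_pure]
    filter_upwards [hev] with s hs
    simp [σ, hs]
  have hconvB : ConvergesToOne (fun s : S => f s) := by
    rw [ConvergesToOne, nhds_discrete, tendsto_pure]
    exact hev
  obtain ⟨f', ⟨hf'c, hf'⟩, -⟩ := hS.existsUnique_extension A (isProP_of_finite hA) _ hconvA
  refine ⟨f', (hS.existsUnique_extension B (isProP_of_finite hB) _ hconvB).unique
    ⟨?_, fun s => ?_⟩ ⟨hfc, fun _ => rfl⟩⟩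
  · exact (continuous_of_discreteTopology (f := π)).comp hf'c
  · simp [hf', hσ]

/-! ### Monomial induction and wreath products -/

section Induction

variable {G : Type u} [Group G] (S : Subgroup G)

/-- The monomial homomorphism of `G` induced by a homomorphism on a subgroup `S`. -/
noncomputable def monomialHom {Q : Type} [Group Q] (φ : S →* Q) :
    G →* (G ⧸ S → Q) ⋊[mulAutArrow] G where
  toFun g := ⟨fun x => φ ⟨x.out⁻¹ * g * (g⁻¹ • x).out, by
    rw [mul_assoc, ← QuotientGroup.eq, ← smul_eq_mul, MulAction.Quotient.coe_smul_out]
    simp⟩, g⟩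
  map_one' := by
    ext x
    · simp only [SemidirectProduct.one_left, Pi.one_apply]
      rw [← map_one φ]
      congr 1
      ext
      simp
    · rfl
  map_mul' g h := by
    ext x
    · simp only [SemidirectProduct.mul_left, Pi.mul_apply, mulAutArrow_apply_apply]
      change _ = _ * φ _
      rw [← map_mul]
      congr 1
      ext
      simp [mul_assoc, mul_smul]
    · rfl

/-- Postcomposition on the base of a permutational wreath product. -/
def wreathMap {E Q : Type} [Group E] [Group Q] (π : E →* Q) :
    ((G ⧸ S → E) ⋊[mulAutArrow] G) →* ((G ⧸ S → Q) ⋊[mulAutArrow] G) :=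
  SemidirectProduct.map (π.compLeft (G ⧸ S)) (MonoidHom.id G) (fun _ => rfl)

theorem wreathMap_surjective {E Q : Type} [Group E] [Group Q] {π : E →* Q}
    (hπ : Function.Surjective π) : Function.Surjective (wreathMap S π) := fun y =>
  ⟨⟨fun x => Function.surjInv hπ (y.left x), y.right⟩, by
    ext x
    · exact Function.surjInv_eq hπ _
    · rfl⟩

theorem isPGroup_wreath {p : ℕ} [Fact p.Prime] [Finite G] (hG : IsPGroup p G) {E : Type}
    [Group E] [Finite E] (hE : IsPGroup p E) :
    IsPGroup p ((G ⧸ S → E) ⋊[mulAutArrow] G) := by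
  obtain ⟨m, hm⟩ := IsPGroup.iff_card.1 hG
  obtain ⟨n, hn⟩ := IsPGroup.iff_card.1 hE
  refine IsPGroup.of_card (n := n * Nat.card (G ⧸ S) + m) ?_
  rw [SemidirectProduct.card, Nat.card_fun, hm, hn, pow_add, pow_mul]

instance finite_wreath [Finite G] {E : Type} [Group E] [Finite E] :
    Finite ((G ⧸ S → E) ⋊[mulAutArrow] G) :=
  Finite.of_equiv _ SemidirectProduct.equivProd.symm

end Induction

/-- Preimages in a free pro-`p` group of subgroups of a finite quotient are projective with respect
to surjections of finite `p`-groups. -/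
theorem IsFreeProP.exists_lift_comap {p : ℕ} [Fact p.Prime] {F : Type u} [Group F]
    [TopologicalSpace F] [IsTopologicalGroup F] (hF : IsFreeProP p F) {G : Type u} [Group G]
    [Finite G] (hG : IsPGroup p G) (q : F →* G) (hq : IsOpen (q.ker : Set F)) (S : Subgroup G)
    {E Q : Type} [Group E] [Group Q] [Finite E] [Finite Q] (hE : IsPGroup p E)
    (hQ : IsPGroup p Q) (π : E →* Q) (hπ : Function.Surjective π) (φ : S →* Q) :
    ∃ ψ : S.comap q →* E, ∀ x : S.comap q, π (ψ x) = φ ⟨q x, x.2⟩ := by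
  have hopen : IsOpen (((monomialHom S φ).comp q).ker : Set F) :=
    Subgroup.isOpen_mono (fun x hx => by
      rw [MonoidHom.mem_ker, MonoidHom.comp_apply, MonoidHom.mem_ker.1 hx, map_one]) hq
  obtain ⟨Φ, hΦ⟩ := hF.exists_lift (isPGroup_wreath S hG hE) (isPGroup_wreath S hG hQ)
    (wreathMap S π) (wreathMap_surjective S hπ) ((monomialHom S φ).comp q) hopen
  have hright (x : F) : (Φ x).right = q x := congrArg (·.right) (DFunLike.congr_fun hΦ x)
  have hleft (x : F) (y : G ⧸ S) : π ((Φ x).left y) = (monomialHom S φ (q x)).left y :=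
    congrFun (congrArg (·.left) (DFunLike.congr_fun hΦ x)) y
  let o : G ⧸ S := ((1 : G) : G ⧸ S)
  have hfix (s : G) (hs : s ∈ S) : s⁻¹ • o = o := by
    change ((s⁻¹ * 1 : G) : G ⧸ S) = _
    rw [QuotientGroup.eq]
    simpa using hs
  have ho : o.out ∈ S := by
    have := QuotientGroup.out_eq' o
    rw [eq_comm, QuotientGroup.eq] at this
    simpa using this
  -- `S` fixes the trivial coset `o`, so the coordinate at `o` is multiplicative over `S`. It lifts
  -- `φ` only up to conjugation by the representative `o.out`, which `e` undoes.
  obtain ⟨e, he⟩ := hπ (φ ⟨o.out, ho⟩)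
  refine ⟨MonoidHom.mk' (fun x => e * (Φ x).left o * e⁻¹) fun x y => ?_, fun x => ?_⟩
  · have hmul : (Φ ((x * y : S.comap q) : F)).left o = (Φ x).left o * (Φ y).left o := by
      rw [Subgroup.coe_mul, map_mul, SemidirectProduct.mul_left, Pi.mul_apply]
      change _ * (Φ y).left ((Φ x).right⁻¹ • o) = _
      rw [hright, hfix _ x.2]
    rw [hmul]
    group
  · simp only [MonoidHom.mk'_apply, map_mul, map_inv, he, hleft]
    change _ * φ _ * _ = _
    rw [← map_inv φ, ← map_mul φ, ← map_mul φ]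
    congr 1
    ext
    simp [hfix _ x.2, mul_assoc]

/-! ### Characters of finite 2-groups, and the two test groups -/

section FiniteGroups

/-- A proper subgroup of a finite `2`-group is killed by a nonzero homomorphism to `ZMod 2`. -/
theorem IsPGroup.exists_hom_ne_one {G : Type*} [Group G] [Finite G] (hG : IsPGroup 2 G)
    {K : Subgroup G} (hK : K ≠ ⊤) :
    ∃ v : G →* Multiplicative (ZMod 2), K ≤ v.ker ∧ v ≠ 1 := by
  obtain ⟨m, hm⟩ := IsPGroup.iff_card.1 hG
  obtain ⟨n, hn⟩ := IsPGroup.iff_card.1 (hG.to_subgroup K)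
  have hlt : n < m := by
    have hle := Subgroup.card_le_card_group K
    refine lt_of_le_of_ne ?_ fun h => hK ((Subgroup.card_eq_iff_eq_top K).1 (by rw [hn, hm, h]))
    rwa [hn, hm, Nat.pow_le_pow_iff_right (by norm_num)] at hle
  obtain ⟨k, rfl⟩ : ∃ k, m = k + 1 := ⟨m - 1, by omega⟩
  -- Enlarge `K` to a subgroup of index 2; its indicator is the character.
  obtain ⟨L, hL, hKL⟩ := Sylow.exists_subgroup_card_pow_prime_le 2 (m := k)
    (hm ▸ pow_dvd_pow 2 k.le_succ) K hn (by omega)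
  have hind : L.index = 2 := by
    have := L.card_mul_index
    rw [hL, hm, pow_succ] at this
    exact Nat.eq_of_mul_eq_mul_left (by positivity) this
  classical
  let v : G →* Multiplicative (ZMod 2) :=
    MonoidHom.mk' (fun g => if g ∈ L then 1 else Multiplicative.ofAdd 1) fun x y => by
      have := Subgroup.mul_mem_iff_of_index_two hind (a := x) (b := y)
      by_cases hx : x ∈ L <;> by_cases hy : y ∈ L <;> (simp [this, hx, hy]; try rfl)
  refine ⟨v, fun x hx => by simp [v, MonoidHom.mem_ker, hKL hx], fun h => ?_⟩
  have htop : L = ⊤ := by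
    refine (Subgroup.eq_top_iff' L).2 fun x => ?_
    have hx : v x = 1 := by rw [h]; rfl
    by_contra hxL
    simp [v, hxL] at hx
  simp [htop] at hind

/-- Reduction `ZMod 4 → ZMod 2`, written multiplicatively. -/
def reduceModTwo : Multiplicative (ZMod 4) →* Multiplicative (ZMod 2) :=
  AddMonoidHom.toMultiplicative (ZMod.castHom (by norm_num : 2 ∣ 4) (ZMod 2)).toAddMonoidHom

theorem reduceModTwo_surjective : Function.Surjective reduceModTwo := by decide

theorem reduceModTwo_relation : ∀ x y z : Multiplicative (ZMod 4), x ^ 2 * y ^ 2 * z ^ 2 = 1 →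
    reduceModTwo x * reduceModTwo y * reduceModTwo z = 1 := by decide

/-- The quotient of the quaternion group of order `8` by its centre. -/
def quaternionMod : QuaternionGroup 2 →* Multiplicative (ZMod 2) × Multiplicative (ZMod 2) :=
  MonoidHom.mk'
    (fun g => match g with
      | .a i => (reduceModTwo (Multiplicative.ofAdd i), 1)
      | .xa i => (reduceModTwo (Multiplicative.ofAdd i), Multiplicative.ofAdd 1))
    (by decide)

theorem quaternionMod_surjective : Function.Surjective quaternionMod := by decide

/-- Noncentral elements all square to the central involution, and the product of three copies of it
is not 1; hence one of the three is central. -/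
theorem quaternionMod_relation : ∀ x y z : QuaternionGroup 2, x ^ 2 * y ^ 2 * z ^ 2 = 1 →
    quaternionMod x = 1 ∨ quaternionMod y = 1 ∨ quaternionMod z = 1 ∨
      quaternionMod x * quaternionMod y * quaternionMod z ≠ 1 := by decide

theorem isPGroup_zmod_two : IsPGroup 2 (Multiplicative (ZMod 2)) :=
  IsPGroup.of_card (n := 1) (by simp)

theorem isPGroup_zmod_four : IsPGroup 2 (Multiplicative (ZMod 4)) :=
  IsPGroup.of_card (n := 2) (by simp)

theorem isPGroup_quaternionGroup_two : IsPGroup 2 (QuaternionGroup 2) :=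
  IsPGroup.of_card (n := 3) (by rw [Nat.card_eq_fintype_card, QuaternionGroup.card]; norm_num)

theorem isPGroup_zmod_two_prod : IsPGroup 2 (Multiplicative (ZMod 2) × Multiplicative (ZMod 2)) :=
  IsPGroup.of_card (n := 2) (by simp)

end FiniteGroups

/-- In a finite quotient of a free pro-`2` group, the image of one of two of the elements of a
solution of `a ^ 2 * b ^ 2 * c ^ 2 = 1` generates the image of the solution. -/
theorem IsFreeProP.closure_image_eq_zpowers {F : Type u} [Group F] [TopologicalSpace F]
    [IsTopologicalGroup F] (hF : IsFreeProP 2 F) {a b c : F} (habc : a ^ 2 * b ^ 2 * c ^ 2 = 1)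
    {G : Type u} [Group G] [Finite G] (hG : IsPGroup 2 G) (q : F →* G)
    (hq : IsOpen (q.ker : Set F)) :
    Subgroup.closure {q a, q b, q c} ≤ Subgroup.zpowers (q a) ∨
      Subgroup.closure {q a, q b, q c} ≤ Subgroup.zpowers (q b) := by
  by_contra! hne
  obtain ⟨hna, hnb⟩ := hne
  set S := Subgroup.closure {q a, q b, q c} with hS
  have ha : q a ∈ S := Subgroup.subset_closure (by simp)
  have hb : q b ∈ S := Subgroup.subset_closure (by simp)
  have hc : q c ∈ S := Subgroup.subset_closure (by simp)
  have hrel : (⟨a, ha⟩ : S.comap q) ^ 2 * (⟨b, hb⟩ : S.comap q) ^ 2 *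
      (⟨c, hc⟩ : S.comap q) ^ 2 = 1 := Subtype.ext habc
  have hsum (v : S →* Multiplicative (ZMod 2)) :
      v ⟨q a, ha⟩ * v ⟨q b, hb⟩ * v ⟨q c, hc⟩ = 1 := by
    obtain ⟨ψ, hψ⟩ := hF.exists_lift_comap hG q hq S isPGroup_zmod_four isPGroup_zmod_two
      reduceModTwo reduceModTwo_surjective v
    have := reduceModTwo_relation _ _ _
      (by simpa only [map_mul, map_pow, map_one] using congrArg ψ hrel)
    simpa only [hψ] using this
  have hext (v : S →* Multiplicative (ZMod 2)) (h1 : v ⟨q a, ha⟩ = 1) (h2 : v ⟨q b, hb⟩ = 1)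
      (h3 : v ⟨q c, hc⟩ = 1) : v = 1 := by
    have hle : S ≤ v.ker.map S.subtype := by
      conv_lhs => rw [hS]
      rw [Subgroup.closure_le]
      rintro x (rfl | rfl | rfl)
      · exact ⟨_, h1, rfl⟩
      · exact ⟨_, h2, rfl⟩
      · exact ⟨_, h3, rfl⟩
    ext1 x
    obtain ⟨y, hy, hyx⟩ := hle x.2
    rwa [← Subtype.ext hyx]
  have hproper (x : G) (hx : x ∈ S) (h : ¬ S ≤ Subgroup.zpowers x) :
      ∃ v : S →* Multiplicative (ZMod 2), v ⟨x, hx⟩ = 1 ∧ v ≠ 1 := by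
    obtain ⟨v, hv, hv1⟩ := (hG.to_subgroup S).exists_hom_ne_one
      (K := Subgroup.zpowers (⟨x, hx⟩ : S)) (fun htop => h fun y hy => by
        obtain ⟨n, hn⟩ := Subgroup.mem_zpowers_iff.1
          (htop ▸ Subgroup.mem_top (⟨y, hy⟩ : S))
        exact Subgroup.mem_zpowers_iff.2 ⟨n, congrArg Subtype.val hn⟩)
    exact ⟨v, hv (Subgroup.mem_zpowers _), hv1⟩
  obtain ⟨v, hva, hv⟩ := hproper _ ha hna
  obtain ⟨w, hwb, hw⟩ := hproper _ hb hnb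
  obtain ⟨ψ, hψ⟩ := hF.exists_lift_comap hG q hq S isPGroup_quaternionGroup_two
    isPGroup_zmod_two_prod quaternionMod quaternionMod_surjective (v.prod w)
  have hquat := quaternionMod_relation _ _ _
    (by simpa only [map_mul, map_pow, map_one] using congrArg ψ hrel)
  have hvsum := hsum v
  have hwsum := hsum w
  -- As `v` kills a and its three values multiply to 1, killing b would force it to kill c, hence
  -- all of `S`. The same holds for `w` with a and b exchanged.
  have hv' : v ⟨q b, hb⟩ ≠ 1 := fun h => hv (hext v hva h (by simpa [hva, h] using hvsum))
  have hw' : w ⟨q a, ha⟩ ≠ 1 := fun h => hw (hext w h hwb (by simpa [hwb, h] using hwsum))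
  simp only [hψ, MonoidHom.prod_apply, Prod.mk_eq_one, Prod.mk_mul_mk, ne_eq] at hquat
  rcases hquat with h | h | h | h
  · exact hw' h.2
  · exact hv' h.1
  · exact hv' (by simpa [hva, h.1] using hvsum)
  · exact h ⟨hvsum, hwsum⟩

/-! ### From finite quotients to closed subgroups -/

section Topology

variable {F : Type u} [Group F] [TopologicalSpace F] [IsTopologicalGroup F]

/-- In a profinite group, a closed subgroup contains every element that it contains modulo each open
normal subgroup. -/
theorem mem_of_forall_openNormalSubgroup [CompactSpace F] [TotallyDisconnectedSpace F]
    {K : Subgroup F} (hK : IsClosed (K : Set F)) {x : F}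
    (h : ∀ N : OpenNormalSubgroup F, ∃ y ∈ K, y⁻¹ * x ∈ N.toSubgroup) : x ∈ K := by
  by_contra hx
  have hopen : IsOpen {n : F | x * n⁻¹ ∉ K} :=
    (hK.preimage (continuous_const.mul continuous_inv)).isOpen_compl
  obtain ⟨N, hN⟩ := ProfiniteGrp.exist_openNormalSubgroup_sub_open_nhds_of_one hopen (by simpa)
  obtain ⟨y, hy, hyx⟩ := h N
  exact hN hyx (by simpa using hy)

theorem mul_comm_of_mem_closedSubgroupGenerated_singleton [T2Space F] {g x y : F}
    (hx : x ∈ closedSubgroupGenerated {g}) (hy : y ∈ closedSubgroupGenerated {g}) :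
    x * y = y * x := by
  let := (Subgroup.closure {g}).commGroupTopologicalClosure fun u v => by
    obtain ⟨m, hm⟩ := Subgroup.mem_closure_singleton.1 u.2
    obtain ⟨n, hn⟩ := Subgroup.mem_closure_singleton.1 v.2
    ext
    simp [← hm, ← hn, ← zpow_add, add_comm]
  exact congrArg Subtype.val (mul_comm (⟨x, hx⟩ : (Subgroup.closure {g}).topologicalClosure)
    ⟨y, hy⟩)

theorem closedSubgroupGenerated_le_iff {S : Set F} {K : Subgroup F} (hK : IsClosed (K : Set F)) :
    closedSubgroupGenerated S ≤ K ↔ S ⊆ K :=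
  ⟨fun h => Subgroup.subset_closure.trans ((Subgroup.le_topologicalClosure _).trans h),
    fun h => Subgroup.topologicalClosure_minimal _ ((Subgroup.closure_le K).2 h) hK⟩

end Topology

/-- A solution of `a ^ 2 * b ^ 2 * c ^ 2 = 1` in a free pro-`2` group topologically generates the
same subgroup as one of `a` and `b`. -/
theorem IsFreeProP.closedSubgroupGenerated_eq {F : Type u} [Group F] [TopologicalSpace F]
    [IsTopologicalGroup F] (hF : IsFreeProP 2 F) {a b c : F}
    (habc : a ^ 2 * b ^ 2 * c ^ 2 = 1) :
    closedSubgroupGenerated {a, b, c} = closedSubgroupGenerated {a} ∨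
      closedSubgroupGenerated {a, b, c} = closedSubgroupGenerated {b} := by
  have := hF.1.compactSpace
  have := hF.1.totallyDisconnectedSpace
  have hclosed (S : Set F) : IsClosed (closedSubgroupGenerated S : Set F) :=
    Subgroup.isClosed_topologicalClosure _
  have hgen (S : Set F) {x : F} (hx : x ∈ S) : x ∈ closedSubgroupGenerated S :=
    Subgroup.le_topologicalClosure _ (Subgroup.subset_closure hx)
  have hle (g : F) (hg : g ∈ ({a, b, c} : Set F)) :
      closedSubgroupGenerated {g} ≤ closedSubgroupGenerated {a, b, c} := by
    rw [closedSubgroupGenerated_le_iff (hclosed _)]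
    exact Set.singleton_subset_iff.2 (hgen _ hg)
  have hquot (N : OpenNormalSubgroup F) :
      (∀ x ∈ ({a, b, c} : Set F), ∃ y ∈ closedSubgroupGenerated {a}, y⁻¹ * x ∈ N.toSubgroup) ∨
      (∀ x ∈ ({a, b, c} : Set F), ∃ y ∈ closedSubgroupGenerated {b}, y⁻¹ * x ∈ N.toSubgroup) := by
    have : Finite (F ⧸ N.toSubgroup) :=
      Subgroup.quotient_finite_of_isOpen _ N.isOpen'
    have key (g : F) (h : Subgroup.closure {QuotientGroup.mk' N.toSubgroup a,
        QuotientGroup.mk' N.toSubgroup b, QuotientGroup.mk' N.toSubgroup c} ≤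
        Subgroup.zpowers (QuotientGroup.mk' N.toSubgroup g)) (x : F)
        (hx : x ∈ ({a, b, c} : Set F)) :
        ∃ y ∈ closedSubgroupGenerated {g}, y⁻¹ * x ∈ N.toSubgroup := by
      obtain ⟨n, hn⟩ := Subgroup.mem_zpowers_iff.1
        (h (Subgroup.subset_closure (by rcases hx with rfl | rfl | rfl <;> simp) :
          QuotientGroup.mk' N.toSubgroup x ∈ _))
      exact ⟨g ^ n, zpow_mem (hgen {g} (Set.mem_singleton g)) n,
        QuotientGroup.eq.1 ((map_zpow (QuotientGroup.mk' N.toSubgroup) g n).trans hn)⟩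
    refine (hF.closure_image_eq_zpowers habc (hF.1.isPGroup_quotient N)
      (QuotientGroup.mk' N.toSubgroup) ?_).imp (key a) (key b)
    rw [QuotientGroup.ker_mk']
    exact N.isOpen'
  by_cases h : ∀ N : OpenNormalSubgroup F, ∀ x ∈ ({a, b, c} : Set F),
      ∃ y ∈ closedSubgroupGenerated {a}, y⁻¹ * x ∈ N.toSubgroup
  · refine Or.inl (le_antisymm ?_ (hle a (by simp)))
    rw [closedSubgroupGenerated_le_iff (hclosed {a})]
    exact fun x hx => mem_of_forall_openNormalSubgroup (hclosed {a}) fun N => h N x hx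
  · obtain ⟨N, hN⟩ := not_forall.1 h
    refine Or.inr (le_antisymm ?_ (hle b (by simp)))
    rw [closedSubgroupGenerated_le_iff (hclosed {b})]
    refine fun x hx => mem_of_forall_openNormalSubgroup (hclosed {b}) fun M => ?_
    -- Which of a, b works may depend on the quotient. If a fails modulo `N`, it fails modulo the
    -- smaller `M ⊓ N`, so b works there and hence modulo `M`.
    rcases hquot (M ⊓ N) with hMN | hMN
    · refine absurd (fun y hy => ?_) hN
      obtain ⟨z, hz, hzy⟩ := hMN y hy
      exact ⟨z, hz, hzy.2⟩
    · obtain ⟨z, hz, hzx⟩ := hMN x hx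
      exact ⟨z, hz, hzx.1⟩

theorem mainTheorem4 (F : Type u) [Group F] [TopologicalSpace F] [IsTopologicalGroup F]
    (hF : IsFreeProP 2 F) (a b c : F) (habc : a ^ 2 * b ^ 2 * c ^ 2 = 1) :
    (∀ x ∈ closedSubgroupGenerated {a, b, c}, ∀ y ∈ closedSubgroupGenerated {a, b, c},
      x * y = y * x) ∧
    IsProcyclicSubgroup (closedSubgroupGenerated {a, b, c}) := by
  have := hF.1.t2Space
  obtain ⟨g, hg⟩ : ∃ g, closedSubgroupGenerated {a, b, c} = closedSubgroupGenerated {g} :=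
    (hF.closedSubgroupGenerated_eq habc).elim (fun h => ⟨a, h⟩) (fun h => ⟨b, h⟩)
  refine ⟨fun x hx y hy => ?_, g, hg⟩
  rw [hg] at hx hy
  exact mul_comm_of_mem_closedSubgroupGenerated_singleton hx hy
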